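/- Let $G$ be a connected simple non-compact Lie group of Hermitian type, contained in its universal complexification $G_{\mathbb C}$, which is assumed simply connected; thus the simple Lie algebra $\mathfrak g$ of $G$ is a real form of the Lie algebra $\mathfrak g_{\mathbb C}$ of $G_{\mathbb C}$, and $G$ is the analytic subgroup of $G_{\mathbb C}$ with Lie algebra $\mathfrak g$. Let $K<G$ be a maximal compact subgroup with Lie algebra $\mathfrak k$, let $\mathfrak p$ be the orthogonal complement of $\mathfrak k$ in $\mathfrak g$ for the Cartan–Killing form, and let $K_{\mathbb C}<G_{\mathbb C}$ be the analytic subgroup with Lie algebra $\mathfrak k_{\mathbb C}$. As $G$ is Hermitian, there is an element $Z$ of the centre of $\mathfrak k$ with $(\operatorname{ad}Z)^2=-1$ on $\mathfrak p$. Fix one, and let $P^{\pm}<G_{\mathbb C}$ be the analytic subgroups with Lie algebras $\mathfrak p^{\pm}=\{Y\in\mathfrak p_{\mathbb C}\mid [Z,Y]=\pm iY\}$. The group $K_{\mathbb C}$ normalizes $P^\pm$. Put $$X_{\mathbb C}=G_{\mathbb C}/K_{\mathbb C},\qquad F^{\pm}=G_{\mathbb C}/K_{\mathbb C}P^{\pm},\qquad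 D^{\pm}=GK_{\mathbb C}P^{\pm}/K_{\mathbb C}P^{\pm}\subseteq F^{\pm},$$ and let $z^{\pm}\in F^{\pm}$ be the base points. Call $z\in F^+$ and $w\in F^-$ transversal if there is $g\in G_{\mathbb C}$ with $z=gz^+$ and $w\in gP^+z^-$. For $A\subseteq F^+$ and $B\subseteq F^-$ let $A\times_\intercal B$ be the set of transversal pairs in $A\times B$. The map $X_{\mathbb C}\hookrightarrow F^+\times F^-$, $gK_{\mathbb C}\mapsto(gK_{\mathbb C}P^+,gK_{\mathbb C}P^-)$, identifies $X_{\mathbb C}$ with $F^+\times_\intercal F^-$. Under this identification set $$\Xi^+=D^+\times_\intercal F^-,\qquad \Xi^-=F^+\times_\intercal D^-.$$ For $D\subseteq X_{\mathbb C}$ let $DK_{\mathbb C}$ denote the preimage of $D$ in $G_{\mathbb C}$ under the canonical projection $G_{\mathbb C}\to X_{\mathbb C}$. Then $$\text{(i)}\quad \Xi^+K_{\mathbb C}=GK_{\mathbb C}P^+,\qquad\qquad \text{(ii)}\quad \Xi^-K_{\mathbb C}=GK_{\mathbb C}P^-.$$ -/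

import Mathlib

open scoped Manifold ContDiff Pointwise

noncomputable section

namespace HermitianCrown

/-! ### One-parameter groups and analytic subgroups of a complex Lie group -/

section LieTheory

variable {E : Type*} [NormedAddCommGroup E] [NormedSpace ℂ E]
  {GC : Type*} [TopologicalSpace GC] [ChartedSpace E GC] [Group GC]

/-- `γ` is the holomorphic one-parameter group `s ↦ exp (s X)`: a homomorphism `ℂ → GC` with
derivative `X` at `0` (it is then holomorphic everywhere, by translation, and unique).
Hence `exp X = γ 1`. -/
def IsOneParam (γ : ℂ → GC) (X : GroupLieAlgebra 𝓘(ℂ, E) GC) : Prop :=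
  (∀ s t : ℂ, γ (s + t) = γ s * γ t) ∧
    HasMFDerivAt 𝓘(ℂ, ℂ) 𝓘(ℂ, E) γ 0 (ContinuousLinearMap.toSpanSingleton ℂ (X : E))

/-- The analytic subgroup attached to a set `h` of Lie algebra elements (in practice a real or
complex Lie subalgebra): the subgroup generated by `exp h`. -/
def analyticSubgroup (h : Set (GroupLieAlgebra 𝓘(ℂ, E) GC)) : Subgroup GC :=
  Subgroup.closure {a | ∃ X ∈ h, ∃ γ : ℂ → GC, IsOneParam γ X ∧ γ 1 = a}

/-- The (real) Lie algebra of a closed subgroup `L`: all `X` with `exp (t X) ∈ L` for `t` real. -/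
def lieOf (L : Subgroup GC) : Set (GroupLieAlgebra 𝓘(ℂ, E) GC) :=
  {X | ∃ γ : ℂ → GC, IsOneParam γ X ∧ ∀ t : ℝ, γ t ∈ L}

/-- The analytic subgroup with Lie algebra `𝔨_ℂ = 𝔨 + i 𝔨`, where `𝔨` is the Lie algebra of the
closed subgroup `K`. -/
def complexifiedSubgroup (E : Type*) [NormedAddCommGroup E] [NormedSpace ℂ E]
    {GC : Type*} [TopologicalSpace GC] [ChartedSpace E GC] [Group GC]
    (K : Subgroup GC) : Subgroup GC :=
  analyticSubgroup
    (Submodule.span ℂ (lieOf (E := E) K) : Set (GroupLieAlgebra 𝓘(ℂ, E) GC))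

variable [CompleteSpace E] [LieGroup 𝓘(ℂ, E) ω GC]

/-- The Lie algebra of a complex Lie group, regarded as a real Lie algebra. -/
instance instRealLieAlgebra : LieAlgebra ℝ (GroupLieAlgebra 𝓘(ℂ, E) GC) where
  lie_smul t x m := by
    have h := lie_smul (t : ℂ) x m
    simpa only [Complex.coe_smul] using h

/-- `g` is a real form of the complex Lie algebra of `GC`: every element is `A + i B` for unique
`A, B ∈ g`. -/
def IsRealForm (g : LieSubalgebra ℝ (GroupLieAlgebra 𝓘(ℂ, E) GC)) : Prop :=
  Function.Bijective fun x : g × g =>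
    (x.1 : GroupLieAlgebra 𝓘(ℂ, E) GC) + Complex.I • (x.2 : GroupLieAlgebra 𝓘(ℂ, E) GC)

/-- The orthogonal complement `𝔭` in `g` of the Lie algebra of `K`, with respect to the
Cartan-Killing form of the real Lie algebra `g`. -/
def cartanComplement (g : LieSubalgebra ℝ (GroupLieAlgebra 𝓘(ℂ, E) GC)) (K : Subgroup GC) :
    Set (GroupLieAlgebra 𝓘(ℂ, E) GC) :=
  {Y | ∃ hY : Y ∈ g, ∀ X : g, (X : GroupLieAlgebra 𝓘(ℂ, E) GC) ∈ lieOf (E := E) K →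
    killingForm ℝ g X ⟨Y, hY⟩ = 0}

/-- `Z` is a central element of `𝔨` such that `ad Z` is a complex structure on `𝔭`. For `g`
simple and non-compact, such a `Z` exists if and only if `𝔨` has non-zero centre, that is, if and
only if `G` is of Hermitian type; it is then unique up to sign, and its two choices correspond to
the two invariant complex structures on `G/K`. -/
def IsHermitianElement (g : LieSubalgebra ℝ (GroupLieAlgebra 𝓘(ℂ, E) GC)) (K : Subgroup GC)
    (Z : GroupLieAlgebra 𝓘(ℂ, E) GC) : Prop :=
  Z ∈ lieOf (E := E) K ∧ (∀ X ∈ lieOf (E := E) K, ⁅Z, X⁆ = 0) ∧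
    ∀ Y ∈ cartanComplement g K, ⁅Z, ⁅Z, Y⁆⁆ = -Y

/-- The subgroup `exp {Y ∈ 𝔭_ℂ | [Z, Y] = c Y}`, where `𝔭_ℂ` is the complex span of `𝔭`. -/
def eigenSubgroup (g : LieSubalgebra ℝ (GroupLieAlgebra 𝓘(ℂ, E) GC)) (K : Subgroup GC)
    (Z : GroupLieAlgebra 𝓘(ℂ, E) GC) (c : ℂ) : Subgroup GC :=
  analyticSubgroup {Y : GroupLieAlgebra 𝓘(ℂ, E) GC |
    Y ∈ Submodule.span ℂ (cartanComplement g K) ∧ ⁅Z, Y⁆ = c • Y}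

/-- `P⁺`, with Lie algebra `𝔭⁺`, the `i`-eigenspace of `ad Z` on `𝔭_ℂ`. -/
def PPlus (g : LieSubalgebra ℝ (GroupLieAlgebra 𝓘(ℂ, E) GC)) (K : Subgroup GC)
    (Z : GroupLieAlgebra 𝓘(ℂ, E) GC) : Subgroup GC :=
  eigenSubgroup g K Z Complex.I

/-- `P⁻`, with Lie algebra `𝔭⁻`, the `-i`-eigenspace of `ad Z` on `𝔭_ℂ`. -/
def PMinus (g : LieSubalgebra ℝ (GroupLieAlgebra 𝓘(ℂ, E) GC)) (K : Subgroup GC)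
    (Z : GroupLieAlgebra 𝓘(ℂ, E) GC) : Subgroup GC :=
  eigenSubgroup g K Z (-Complex.I)

end LieTheory

/-! ### Flag varieties, flag domains and the sets `Ξ⁺`, `Ξ⁻` -/

section Flags

variable {GC : Type*} [Group GC]

/-- The flag variety `GC / KC P`. (In the Hermitian case `KC` normalizes `P`, so that the product
set `KC P` is the subgroup generated by `KC` and `P`.) -/
abbrev Flag (KC P : Subgroup GC) : Type _ := GC ⧸ (KC ⊔ P)

/-- The flag domain `G KC P / KC P` in `GC / KC P`. -/
def flagDomain (G KC P : Subgroup GC) : Set (Flag KC P) :=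
  (fun a : GC => (a : Flag KC P)) '' ((G : Set GC) * (KC : Set GC) * (P : Set GC))

/-- Transversality of `z ∈ F⁺ = GC / KC P⁺` and `w ∈ F⁻ = GC / KC P⁻`: the `GC`-invariant relation
for which the points transversal to the base point `z⁺` of `F⁺` are those of `P⁺ z⁻`, with `z⁻`
the base point of `F⁻`. -/
def Transversal (KC Pp Pm : Subgroup GC) (z : Flag KC Pp) (w : Flag KC Pm) : Prop :=
  ∃ a : GC, z = (a : Flag KC Pp) ∧ ∃ p ∈ Pp, w = ((a * p : GC) : Flag KC Pm)

/-- The pairs in `A × B` which are transversal. -/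
def transversalProd (KC Pp Pm : Subgroup GC) (A : Set (Flag KC Pp)) (B : Set (Flag KC Pm)) :
    Set (Flag KC Pp × Flag KC Pm) :=
  {x | x.1 ∈ A ∧ x.2 ∈ B ∧ Transversal KC Pp Pm x.1 x.2}

/-- The map `X_ℂ = GC / KC → F⁺ × F⁻`, `a KC ↦ (a KC P⁺, a KC P⁻)`. -/
def toFlags (KC Pp Pm : Subgroup GC) (x : GC ⧸ KC) : Flag KC Pp × Flag KC Pm :=
  (Subgroup.quotientMapOfLE le_sup_left x, Subgroup.quotientMapOfLE le_sup_left x)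

/-- `Ξ⁺ = D⁺ ×_⊤ F⁻`, as a subset of `X_ℂ`. -/
def XiPlus (G KC Pp Pm : Subgroup GC) : Set (GC ⧸ KC) :=
  toFlags KC Pp Pm ⁻¹' transversalProd KC Pp Pm (flagDomain G KC Pp) Set.univ

/-- `Ξ⁻ = F⁺ ×_⊤ D⁻`, as a subset of `X_ℂ`. -/
def XiMinus (G KC Pp Pm : Subgroup GC) : Set (GC ⧸ KC) :=
  toFlags KC Pp Pm ⁻¹' transversalProd KC Pp Pm Set.univ (flagDomain G KC Pm)

/-- `D KC`, the preimage of `D ⊆ X_ℂ = GC / KC` in `GC` under the canonical projection. -/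
def preimageInGroup (KC : Subgroup GC) (D : Set (GC ⧸ KC)) : Set GC :=
  (fun a : GC => (a : GC ⧸ KC)) ⁻¹' D

end Flags

end HermitianCrown

end

open HermitianCrown

/-! A coset `a KC` always gives a transversal pair, so transversality costs nothing in the preimage
of Ξ⁺: an element `a` lies in Ξ⁺K_ℂ exactly when its class in F⁺ lies in D⁺, that is, when `a` lies
in G K_ℂ P⁺ times the group generated by K_ℂ and P⁺. As K_ℂ normalizes P⁺, that group is K_ℂP⁺ and
is absorbed. The same holds for the sign minus.

The work is in the normalization, `complexifiedSubgroup_le_normalizer`. Since a exp(Y) a⁻¹ =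
exp(Ad(a)Y) and Ad(exp tX)Y solves u' = [X, u], it reduces to [𝔨_ℂ, 𝔭^±] ⊆ 𝔭^±. The eigenvalue is
kept because Z commutes with 𝔨_ℂ, and [𝔨, 𝔭] ⊆ 𝔭 follows from invariance of the Killing form once 𝔨
⊆ 𝔤 is known.

That inclusion, `lieOf_subset`, avoids determining the Lie algebra of the possibly non-closed
subgroup G. If exp(tX) ∈ G for all real t, then Ad(exp tX) preserves 𝔤, hence so does ad X, and a
simple real form is its own normalizer.

The identity d(Ad) = ad, `exists_hasFDerivAt_adjointAction`, is a second-derivative computation in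
the chart at 1. -/

open scoped Manifold ContDiff Pointwise

noncomputable section

namespace HermitianCrown

/-! ### Second derivatives of a local product and its conjugation -/

/-- If `c` is conjugation for a local product `m` with unit `e`, i.e. `m (c (x, y), x) = m (x, y)`,
then the mixed second derivative of `c` is the antisymmetrisation of the one of `m`. -/
theorem fderiv_fderiv_conj {E : Type*} [NormedAddCommGroup E] [NormedSpace ℂ E]
    {m c : E × E → E} {e : E} (hm : ContDiffAt ℂ 2 m (e, e)) (hc : ContDiffAt ℂ 2 c (e, e))
    (hm1 : ∀ᶠ x in nhds e, m (x, e) = x)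
    (hc1 : ∀ᶠ x in nhds e, c (e, x) = x) (hc2 : ∀ᶠ x in nhds e, c (x, e) = e)
    (hmc : ∀ᶠ p in nhds (e, e), m (c p, p.1) = m p) (X Y : E) :
    fderiv ℂ (fderiv ℂ c) (e, e) (X, 0) (0, Y) =
      fderiv ℂ (fderiv ℂ m) (e, e) (X, 0) (0, Y) -
        fderiv ℂ (fderiv ℂ m) (e, e) (Y, 0) (0, X) := by
  have hm' : DifferentiableAt ℂ (fderiv ℂ m) (e, e) :=
    (hm.fderiv_right (m := 1) (by norm_num)).differentiableAt (by norm_num)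
  have hc' : DifferentiableAt ℂ (fderiv ℂ c) (e, e) :=
    (hc.fderiv_right (m := 1) (by norm_num)).differentiableAt (by norm_num)
  have hdm : ∀ᶠ p in nhds (e, e), DifferentiableAt ℂ m p :=
    (hm.eventually (by simp)).mono fun p h => h.differentiableAt (by norm_num)
  have hdc : ∀ᶠ p in nhds (e, e), DifferentiableAt ℂ c p :=
    (hc.eventually (by simp)).mono fun p h => h.differentiableAt (by norm_num)
  have hl : HasFDerivAt (fun x : E => (x, e)) (ContinuousLinearMap.inl ℂ E E) e :=
    hasFDerivAt_prodMk_left e e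
  have hr : HasFDerivAt (fun x : E => (e, x)) (ContinuousLinearMap.inr ℂ E E) e :=
    hasFDerivAt_prodMk_right e e
  have tl : Filter.Tendsto (fun x : E => (x, e)) (nhds e) (nhds (e, e)) := hl.continuousAt
  have tr : Filter.Tendsto (fun x : E => (e, x)) (nhds e) (nhds (e, e)) := hr.continuousAt
  have hcY : fderiv ℂ c (e, e) (0, Y) = Y := by
    have h1 := (hdc.self_of_nhds).hasFDerivAt.comp e hr
    have h2 : HasFDerivAt (c ∘ fun x : E => (e, x)) (ContinuousLinearMap.id ℂ E) e :=
      (hasFDerivAt_id e).congr_of_eventuallyEq hc1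
    simpa using congrArg (fun L : E →L[ℂ] E => L Y) (h1.unique h2)
  have hmW (W : E) : fderiv ℂ m (e, e) (W, 0) = W := by
    have h1 := HasFDerivAt.comp (f := fun x : E => (x, e)) e (hdm.self_of_nhds).hasFDerivAt hl
    have h2 : HasFDerivAt (m ∘ fun x : E => (x, e)) (ContinuousLinearMap.id ℂ E) e :=
      (hasFDerivAt_id e).congr_of_eventuallyEq hm1
    simpa using congrArg (fun L : E →L[ℂ] E => L W) (h1.unique h2)
  -- Differentiate m(c(x, y), x) = m(x, y) in y at y = e, using c(x, e) = e.
  have key : ∀ᶠ x in nhds e,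
      fderiv ℂ m (x, e) (0, Y) = fderiv ℂ m (e, x) (fderiv ℂ c (x, e) (0, Y), 0) := by
    filter_upwards [tl.eventually hmc.eventually_nhds, tl.eventually hdc, tr.eventually hdm, hc2]
      with x h1 h2 h3 h4
    have h5 : HasFDerivAt (fun p : E × E => (c p, p.1))
        ((fderiv ℂ c (x, e)).prod (ContinuousLinearMap.fst ℂ E E)) (x, e) :=
      h2.hasFDerivAt.prodMk hasFDerivAt_fst
    have h6 : HasFDerivAt m (fderiv ℂ m (e, x)) ((fun p : E × E => (c p, p.1)) (x, e)) := by
      simpa [h4] using h3.hasFDerivAt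
    have h7 := (h6.comp (x, e) h5).congr_of_eventuallyEq (h1.mono fun p hp => hp.symm)
    rw [h7.fderiv]
    simp
  have hL : HasFDerivAt (fun x => fderiv ℂ m (x, e) (0, Y)) _ e :=
    (HasFDerivAt.comp (f := fun x : E => (x, e)) e hm'.hasFDerivAt hl).clm_apply (hasFDerivAt_const (0, Y) e)
  have hC : HasFDerivAt (fun x => fderiv ℂ c (x, e) (0, Y)) _ e :=
    (HasFDerivAt.comp (f := fun x : E => (x, e)) e hc'.hasFDerivAt hl).clm_apply (hasFDerivAt_const (0, Y) e)
  have hR : HasFDerivAt (fun x => fderiv ℂ m (e, x) (fderiv ℂ c (x, e) (0, Y), 0)) _ e :=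
    (hm'.hasFDerivAt.comp e hr).clm_apply (hC.prodMk (hasFDerivAt_const (0 : E) e))
  -- Now differentiate `key` in x at e, in the direction X. The product rule yields the mixed
  -- derivative of c plus D²m(0, X)(Y, 0), which symmetry of D²m turns into the subtracted term.
  have hu := congrArg (fun L : E →L[ℂ] E => L X) (hL.unique (hR.congr_of_eventuallyEq key))
  have hs : fderiv ℂ (fderiv ℂ m) (e, e) (0, X) (Y, 0) =
      fderiv ℂ (fderiv ℂ m) (e, e) (Y, 0) (0, X) :=
    (hm.isSymmSndFDerivAt (by simp)) _ _
  simp [hcY, hmW, hs] at hu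
  rw [hu]
  abel

/-- The derivative in the first variable of the partial derivative in the second variable. -/
theorem hasFDerivAt_fderiv_snd {E : Type*} [NormedAddCommGroup E] [NormedSpace ℂ E]
    {f : E × E → E} {e : E} (hf : ContDiffAt ℂ 2 f (e, e)) (Y : E) :
    HasFDerivAt (fun x => fderiv ℂ (fun y => f (x, y)) e Y)
      (((fderiv ℂ (fderiv ℂ f) (e, e)).comp (ContinuousLinearMap.inl ℂ E E)).flip (0, Y)) e := by
  have hf' : DifferentiableAt ℂ (fderiv ℂ f) (e, e) :=
    (hf.fderiv_right (m := 1) (by norm_num)).differentiableAt (by norm_num)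
  have hdf : ∀ᶠ p in nhds (e, e), DifferentiableAt ℂ f p :=
    (hf.eventually (by simp)).mono fun p h => h.differentiableAt (by norm_num)
  have hl : HasFDerivAt (fun x : E => (x, e)) (ContinuousLinearMap.inl ℂ E E) e :=
    hasFDerivAt_prodMk_left e e
  have tl : Filter.Tendsto (fun x : E => (x, e)) (nhds e) (nhds (e, e)) := hl.continuousAt
  have h := (HasFDerivAt.comp (f := fun x : E => (x, e)) e hf'.hasFDerivAt hl).clm_apply
    (hasFDerivAt_const (0, Y) e)
  have heq : (fun x => fderiv ℂ (fun y => f (x, y)) e Y) =ᶠ[nhds e]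
      fun x => fderiv ℂ f (x, e) (0, Y) := by
    filter_upwards [tl.eventually hdf] with x hx
    have := hx.hasFDerivAt.comp e (hasFDerivAt_prodMk_right x e)
    rw [show (fun y => f (x, y)) = f ∘ Prod.mk x from rfl, this.fderiv]
    simp
  refine (h.congr_of_eventuallyEq heq).congr_fderiv ?_
  ext X
  simp

/-! ### One-parameter groups, conjugation and the bracket in the chart at 1 -/

section AdjointAction

variable {E : Type*} [NormedAddCommGroup E] [NormedSpace ℂ E]
  {GC : Type*} [TopologicalSpace GC] [ChartedSpace E GC] [Group GC]

/-- The adjoint action `Ad a`, computed in the preferred chart at the identity. -/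
def adjointAction (E : Type*) [NormedAddCommGroup E] [NormedSpace ℂ E]
    {GC : Type*} [TopologicalSpace GC] [ChartedSpace E GC] [Group GC] (a : GC) : E →L[ℂ] E :=
  fderiv ℂ (fun y => extChartAt 𝓘(ℂ, E) (1 : GC)
    (a * (extChartAt 𝓘(ℂ, E) (1 : GC)).symm y * a⁻¹)) (extChartAt 𝓘(ℂ, E) (1 : GC) 1)

theorem isOneParam_zero {γ : ℂ → GC} {X : GroupLieAlgebra 𝓘(ℂ, E) GC} (h : IsOneParam γ X) :
    γ 0 = 1 := by
  have := h.1 0 0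
  rwa [add_zero, left_eq_mul] at this

/-- Since γ 0 = 1, the manifold derivative at 0 is an ordinary derivative in the chart at 1; all
later calculus takes place there. -/
theorem isOneParam_iff {γ : ℂ → GC} {X : GroupLieAlgebra 𝓘(ℂ, E) GC} :
    IsOneParam γ X ↔ (∀ s t : ℂ, γ (s + t) = γ s * γ t) ∧ ContinuousAt γ 0 ∧
      HasDerivAt (fun s => extChartAt 𝓘(ℂ, E) (1 : GC) (γ s)) (X : E) 0 := by
  refine and_congr_right fun hadd => and_congr_right fun _ => ?_
  have h0 : γ 0 = 1 := by
    have := hadd 0 0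
    rwa [add_zero, left_eq_mul] at this
  have h : writtenInExtChartAt 𝓘(ℂ, ℂ) 𝓘(ℂ, E) 0 γ =
      fun s => extChartAt 𝓘(ℂ, E) (1 : GC) (γ s) := by
    ext s
    simp only [writtenInExtChartAt, h0, Function.comp_apply]
    rfl
  rw [h, modelWithCornersSelf_coe, Set.range_id]
  have h1 : HasFDerivWithinAt (fun s => extChartAt 𝓘(ℂ, E) (1 : GC) (γ s))
      (ContinuousLinearMap.toSpanSingleton ℂ (show E from X)) Set.univ (0 : ℂ) ↔
      HasDerivAt (fun s => extChartAt 𝓘(ℂ, E) (1 : GC) (γ s)) (show E from X) 0 :=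
    hasFDerivWithinAt_univ.trans hasDerivAt_iff_hasFDerivAt.symm
  exact h1

theorem chart_symm_one : (extChartAt 𝓘(ℂ, E) (1 : GC)).symm (extChartAt 𝓘(ℂ, E) (1 : GC) 1) = 1 :=
  extChartAt_to_inv 1

theorem eventually_symm_chart {f : ℂ → GC} {s : ℂ} (hf : ContinuousAt f s) (h : f s = 1) :
    ∀ᶠ t in nhds s,
      (extChartAt 𝓘(ℂ, E) (1 : GC)).symm (extChartAt 𝓘(ℂ, E) (1 : GC) (f t)) = f t := by
  have : ∀ᶠ t in nhds s, f t ∈ (extChartAt 𝓘(ℂ, E) (1 : GC)).source :=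
    hf.eventually (by rw [h]; exact extChartAt_source_mem_nhds 1)
  exact this.mono fun t ht => (extChartAt 𝓘(ℂ, E) (1 : GC)).left_inv ht

theorem contMDiffAt_chart_one :
    ContMDiffAt 𝓘(ℂ, E) 𝓘(ℂ, E) ω (extChartAt 𝓘(ℂ, E) (1 : GC)) 1 :=
  contMDiffAt_extChartAt (n := ω) (I := 𝓘(ℂ, E)) (x := (1 : GC))

variable [LieGroup 𝓘(ℂ, E) ω GC]

theorem contMDiffAt_chart_symm {x : E} (hx : x ∈ (extChartAt 𝓘(ℂ, E) (1 : GC)).target) :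
    ContMDiffAt 𝓘(ℂ, E) 𝓘(ℂ, E) ω (extChartAt 𝓘(ℂ, E) (1 : GC)).symm x :=
  (contMDiffOn_extChartAt_symm (n := ω) (I := 𝓘(ℂ, E)) (1 : GC)).contMDiffAt
    ((isOpen_extChartAt_target (I := 𝓘(ℂ, E)) (1 : GC)).mem_nhds hx)

theorem contMDiff_conj (a : GC) :
    ContMDiff 𝓘(ℂ, E) 𝓘(ℂ, E) ω fun b : GC => a * b * a⁻¹ :=
  (contMDiff_const.mul contMDiff_id).mul contMDiff_const

theorem contDiffAt_chart_conj (a : GC) :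
    ContDiffAt ℂ ω (fun y => extChartAt 𝓘(ℂ, E) (1 : GC)
      (a * (extChartAt 𝓘(ℂ, E) (1 : GC)).symm y * a⁻¹)) (extChartAt 𝓘(ℂ, E) (1 : GC) 1) := by
  rw [← contMDiffAt_iff_contDiffAt]
  exact ContMDiffAt.comp_of_eq (contMDiffAt_chart_one (E := E) (GC := GC))
    ((contMDiff_conj a).contMDiffAt.comp _
      (contMDiffAt_chart_symm (mem_extChartAt_target (I := 𝓘(ℂ, E)) (1 : GC)))) (by simp)

theorem contMDiffAt_chart_symm_fst :
    ContMDiffAt 𝓘(ℂ, E × E) 𝓘(ℂ, E) ω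
      (fun p : E × E => (extChartAt 𝓘(ℂ, E) (1 : GC)).symm p.1)
      (extChartAt 𝓘(ℂ, E) (1 : GC) 1, extChartAt 𝓘(ℂ, E) (1 : GC) 1) :=
  (contMDiffAt_chart_symm (mem_extChartAt_target (I := 𝓘(ℂ, E)) (1 : GC))).comp
    (x := (extChartAt 𝓘(ℂ, E) (1 : GC) 1, extChartAt 𝓘(ℂ, E) (1 : GC) 1)) (f := Prod.fst)
    contDiff_fst.contMDiff.contMDiffAt

theorem contMDiffAt_chart_symm_snd :
    ContMDiffAt 𝓘(ℂ, E × E) 𝓘(ℂ, E) ω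
      (fun p : E × E => (extChartAt 𝓘(ℂ, E) (1 : GC)).symm p.2)
      (extChartAt 𝓘(ℂ, E) (1 : GC) 1, extChartAt 𝓘(ℂ, E) (1 : GC) 1) :=
  (contMDiffAt_chart_symm (mem_extChartAt_target (I := 𝓘(ℂ, E)) (1 : GC))).comp
    (x := (extChartAt 𝓘(ℂ, E) (1 : GC) 1, extChartAt 𝓘(ℂ, E) (1 : GC) 1)) (f := Prod.snd)
    contDiff_snd.contMDiff.contMDiffAt

theorem contDiffAt_chart_mul :
    ContDiffAt ℂ ω (fun p : E × E => extChartAt 𝓘(ℂ, E) (1 : GC)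
      ((extChartAt 𝓘(ℂ, E) (1 : GC)).symm p.1 * (extChartAt 𝓘(ℂ, E) (1 : GC)).symm p.2))
      (extChartAt 𝓘(ℂ, E) (1 : GC) 1, extChartAt 𝓘(ℂ, E) (1 : GC) 1) := by
  rw [← contMDiffAt_iff_contDiffAt]
  exact ContMDiffAt.comp_of_eq (contMDiffAt_chart_one (E := E) (GC := GC))
    (contMDiffAt_chart_symm_fst.mul contMDiffAt_chart_symm_snd) (by simp)

theorem contDiffAt_chart_conj_prod :
    ContDiffAt ℂ ω (fun p : E × E => extChartAt 𝓘(ℂ, E) (1 : GC)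
      ((extChartAt 𝓘(ℂ, E) (1 : GC)).symm p.1 * (extChartAt 𝓘(ℂ, E) (1 : GC)).symm p.2 *
        ((extChartAt 𝓘(ℂ, E) (1 : GC)).symm p.1)⁻¹))
      (extChartAt 𝓘(ℂ, E) (1 : GC) 1, extChartAt 𝓘(ℂ, E) (1 : GC) 1) := by
  rw [← contMDiffAt_iff_contDiffAt]
  exact ContMDiffAt.comp_of_eq (contMDiffAt_chart_one (E := E) (GC := GC))
    ((contMDiffAt_chart_symm_fst.mul contMDiffAt_chart_symm_snd).mul
      contMDiffAt_chart_symm_fst.inv) (by simp)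

/-- Pulling back by the inverse chart means applying the derivative of the chart; by the chain rule
the left-invariant field of X becomes ∂₂m(x, e)X, with m the product in the chart. -/
theorem mpullbackWithin_mulInvariantVectorField (X : GroupLieAlgebra 𝓘(ℂ, E) GC) {x : E}
    (hx : x ∈ (extChartAt 𝓘(ℂ, E) (1 : GC)).target) :
    VectorField.mpullbackWithin 𝓘(ℂ, E) 𝓘(ℂ, E) (extChartAt 𝓘(ℂ, E) (1 : GC)).symm
      (mulInvariantVectorField X) (Set.range 𝓘(ℂ, E)) x =
    fderiv ℂ (fun y => extChartAt 𝓘(ℂ, E) (1 : GC)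
      ((extChartAt 𝓘(ℂ, E) (1 : GC)).symm x * (extChartAt 𝓘(ℂ, E) (1 : GC)).symm y))
      (extChartAt 𝓘(ℂ, E) (1 : GC) 1) (X : E) := by
  set φ := extChartAt 𝓘(ℂ, E) (1 : GC)
  have hs : φ.symm x ∈ (chartAt E (1 : GC)).source := by
    simpa [φ] using φ.map_target hx
  have hinv : (mfderivWithin 𝓘(ℂ, E) 𝓘(ℂ, E) φ.symm (Set.range 𝓘(ℂ, E)) x).inverse =
      mfderiv 𝓘(ℂ, E) 𝓘(ℂ, E) φ (φ.symm x) :=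
    ContinuousLinearMap.inverse_eq
      (mfderivWithin_extChartAt_symm_comp_mfderiv_extChartAt hx)
      (mfderiv_extChartAt_comp_mfderivWithin_extChartAt_symm hx)
  have hL : MDifferentiableAt 𝓘(ℂ, E) 𝓘(ℂ, E) (φ.symm x * ·) (1 : GC) :=
    (contMDiff_mul_left (n := ω)).contMDiffAt.mdifferentiableAt (by simp)
  have hφ : MDifferentiableAt 𝓘(ℂ, E) 𝓘(ℂ, E) φ (φ.symm x * 1) := by
    rw [mul_one]
    exact mdifferentiableAt_extChartAt hs
  have hcomp := mfderiv_comp (1 : GC) hφ hL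
  have hcomp' : (mfderiv 𝓘(ℂ, E) 𝓘(ℂ, E) φ (φ.symm x * 1))
      (mfderiv 𝓘(ℂ, E) 𝓘(ℂ, E) (φ.symm x * ·) (1 : GC) X) =
      mfderiv 𝓘(ℂ, E) 𝓘(ℂ, E) (φ ∘ (φ.symm x * ·)) (1 : GC) X :=
    (DFunLike.congr_fun hcomp X).symm
  have hval : mfderiv 𝓘(ℂ, E) 𝓘(ℂ, E) (φ ∘ (φ.symm x * ·)) (1 : GC) =
     (fderiv ℂ (fun y => φ (φ.symm x * φ.symm y)) (φ 1) : E →L[ℂ] E) := by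
    have hd : MDifferentiableAt 𝓘(ℂ, E) 𝓘(ℂ, E) (φ ∘ (φ.symm x * ·)) (1 : GC) := hφ.comp _ hL
    -- `mfderiv` is a derivative within the range of the model, which is all of E.
    have hu (s : Set E) (hs : s = Set.univ) (f : E → E) (z : E) :
        fderivWithin ℂ f s z = fderiv ℂ f z := by rw [hs, fderivWithin_univ]
    exact hd.mfderiv.trans (hu _ (by simp) _ _)
  rw [hval] at hcomp'
  rw [mul_one] at hcomp'
  refine (congrArg (fun L => L (mulInvariantVectorField X (φ.symm x))) hinv).trans ?_
  exact hcomp'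

/-- The bracket is that of left-invariant vector fields, [V, W] = DW·V − DV·W. In the chart both
fields are partial derivatives of the product, with values X and Y at the identity. -/
theorem bracket_eq_fderiv (X Y : GroupLieAlgebra 𝓘(ℂ, E) GC) [CompleteSpace E] :
    (⁅X, Y⁆ : GroupLieAlgebra 𝓘(ℂ, E) GC) =
      fderiv ℂ (fun x => fderiv ℂ (fun y => extChartAt 𝓘(ℂ, E) (1 : GC)
        ((extChartAt 𝓘(ℂ, E) (1 : GC)).symm x * (extChartAt 𝓘(ℂ, E) (1 : GC)).symm y))
        (extChartAt 𝓘(ℂ, E) (1 : GC) 1) (Y : E)) (extChartAt 𝓘(ℂ, E) (1 : GC) 1) (X : E) -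
      fderiv ℂ (fun x => fderiv ℂ (fun y => extChartAt 𝓘(ℂ, E) (1 : GC)
        ((extChartAt 𝓘(ℂ, E) (1 : GC)).symm x * (extChartAt 𝓘(ℂ, E) (1 : GC)).symm y))
        (extChartAt 𝓘(ℂ, E) (1 : GC) 1) (X : E)) (extChartAt 𝓘(ℂ, E) (1 : GC) 1) (Y : E) := by
  have key (W : GroupLieAlgebra 𝓘(ℂ, E) GC) :
      VectorField.mpullbackWithin 𝓘(ℂ, E) 𝓘(ℂ, E) (extChartAt 𝓘(ℂ, E) (1 : GC)).symm
        (mulInvariantVectorField W) (Set.range 𝓘(ℂ, E)) =ᶠ[nhds (extChartAt 𝓘(ℂ, E) (1 : GC) 1)]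
      fun x => fderiv ℂ (fun y => extChartAt 𝓘(ℂ, E) (1 : GC)
        ((extChartAt 𝓘(ℂ, E) (1 : GC)).symm x * (extChartAt 𝓘(ℂ, E) (1 : GC)).symm y))
        (extChartAt 𝓘(ℂ, E) (1 : GC) 1) (W : E) := by
    filter_upwards [extChartAt_target_mem_nhds (I := 𝓘(ℂ, E)) (1 : GC)] with x hx
    exact mpullbackWithin_mulInvariantVectorField W hx
  have h1 (W : E) : fderiv ℂ (fun y => extChartAt 𝓘(ℂ, E) (1 : GC)
        ((extChartAt 𝓘(ℂ, E) (1 : GC)).symm (extChartAt 𝓘(ℂ, E) (1 : GC) 1) *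
          (extChartAt 𝓘(ℂ, E) (1 : GC)).symm y))
        (extChartAt 𝓘(ℂ, E) (1 : GC) 1) W = W := by
    have : (fun y => extChartAt 𝓘(ℂ, E) (1 : GC)
        ((extChartAt 𝓘(ℂ, E) (1 : GC)).symm (extChartAt 𝓘(ℂ, E) (1 : GC) 1) *
          (extChartAt 𝓘(ℂ, E) (1 : GC)).symm y)) =ᶠ[nhds (extChartAt 𝓘(ℂ, E) (1 : GC) 1)] id := by
      filter_upwards [extChartAt_target_mem_nhds (I := 𝓘(ℂ, E)) (1 : GC)] with x hx
      rw [chart_symm_one, one_mul, PartialEquiv.right_inv _ hx, id]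
    rw [this.fderiv_eq, fderiv_id]
    rfl
  have h2 : (⁅X, Y⁆ : GroupLieAlgebra 𝓘(ℂ, E) GC) =
      VectorField.lieBracket ℂ
        (VectorField.mpullbackWithin 𝓘(ℂ, E) 𝓘(ℂ, E) (extChartAt 𝓘(ℂ, E) (1 : GC)).symm
          (mulInvariantVectorField X) (Set.range 𝓘(ℂ, E)))
        (VectorField.mpullbackWithin 𝓘(ℂ, E) 𝓘(ℂ, E) (extChartAt 𝓘(ℂ, E) (1 : GC)).symm
          (mulInvariantVectorField Y) (Set.range 𝓘(ℂ, E)))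
        (extChartAt 𝓘(ℂ, E) (1 : GC) 1) := by
    rw [GroupLieAlgebra.bracket_def, ← VectorField.mlieBracketWithin_univ,
      VectorField.mlieBracketWithin_apply]
    have hid : (mfderiv 𝓘(ℂ, E) 𝓘(ℂ, E) (extChartAt 𝓘(ℂ, E) (1 : GC)) 1).inverse =
        ContinuousLinearMap.id ℂ E := by
      rw [mfderiv_extChartAt_self]
      exact ContinuousLinearMap.inverse_id
    refine (congrArg (fun L : E →L[ℂ] E => L (_ : E)) hid).trans ?_
    refine congrArg (fun s => VectorField.lieBracketWithin ℂ
      (VectorField.mpullbackWithin 𝓘(ℂ, E) 𝓘(ℂ, E) (extChartAt 𝓘(ℂ, E) (1 : GC)).symm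
          (mulInvariantVectorField X) (Set.range 𝓘(ℂ, E)))
        (VectorField.mpullbackWithin 𝓘(ℂ, E) 𝓘(ℂ, E) (extChartAt 𝓘(ℂ, E) (1 : GC)).symm
          (mulInvariantVectorField Y) (Set.range 𝓘(ℂ, E))) s
        (extChartAt 𝓘(ℂ, E) (1 : GC) 1)) (a₂ := Set.univ) ?_ |>.trans ?_
    · simp
    · exact congrFun VectorField.lieBracketWithin_univ _
  refine h2.trans ((Filter.EventuallyEq.lieBracket_vectorField_eq (key X) (key Y)).trans ?_)
  exact congrArg₂ (· - ·) (congrArg _ (h1 X)) (congrArg _ (h1 Y))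

end AdjointAction

/-! ### Linear differential equations and invariant subspaces -/

/-- A solution of `u' = D u` which starts in a closed `D`-invariant subspace stays in it. -/
theorem mem_of_hasDerivAt_clm_apply {F : Type*} [NormedAddCommGroup F] [NormedSpace ℝ F]
    [CompleteSpace F] {D : F →L[ℝ] F} {u : ℝ → F} (hu : ∀ t, HasDerivAt u (D (u t)) t)
    {S : Submodule ℝ F} (hS : IsClosed (S : Set F)) (hD : ∀ x ∈ S, D x ∈ S) (h0 : u 0 ∈ S)
    (t : ℝ) : u t ∈ S := by
  -- Integrating factor: exp(−sD)u(s) is constant, so u(t) = exp(tD)u(0).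
  have hder (s : ℝ) : HasDerivAt (fun s => NormedSpace.exp (s • -D) (u s)) 0 s := by
    have := (hasDerivAt_exp_smul_const (-D) s).clm_apply (hu s)
    simpa using this
  have hconst : NormedSpace.exp (t • -D) (u t) = u 0 := by
    have := is_const_of_deriv_eq_zero (fun s => (hder s).differentiableAt)
      (fun s => (hder s).deriv) t 0
    simpa using this
  have hinv : NormedSpace.exp (t • D) * NormedSpace.exp (t • -D) = 1 := by
    have hball : ∀ x : F →L[ℝ] F,
        x ∈ Metric.eball (0 : F →L[ℝ] F) (NormedSpace.expSeries ℝ (F →L[ℝ] F)).radius := by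
      simp [NormedSpace.expSeries_radius_eq_top]
    rw [← NormedSpace.exp_add_of_commute_of_mem_ball (𝕂 := ℝ) _ (hball _) (hball _)]
    · simp
    · exact ((Commute.refl D).neg_right.smul_left t).smul_right t
  have hut : u t = NormedSpace.exp (t • D) (u 0) := by
    have := DFunLike.congr_fun hinv (u t)
    simp only [mul_apply_eq_comp] at this
    rw [hconst] at this
    exact this.symm
  rw [hut]
  -- The partial sums of exp(tD)u(0) lie in S, and S is closed.
  have hsum := (NormedSpace.exp_series_hasSum_exp' (𝕂 := ℝ) (t • D)).mapL
    (ContinuousLinearMap.apply ℝ F (u 0))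
  refine hS.mem_of_tendsto hsum (Filter.Eventually.of_forall fun s => ?_)
  refine S.sum_mem fun n _ => ?_
  have hpow (n : ℕ) : ((t • D) ^ n) (u 0) ∈ S := by
    induction n with
    | zero => simpa using h0
    | succ n ih => rw [pow_succ']; exact S.smul_mem t (hD _ ih)
  exact S.smul_mem _ (hpow n)

/-! ### Ad is multiplicative and its derivative is ad -/

section AdjointAction

variable {E : Type*} [NormedAddCommGroup E] [NormedSpace ℂ E]
  {GC : Type*} [TopologicalSpace GC] [ChartedSpace E GC] [Group GC]

theorem adjointAction_one (Y : E) : adjointAction E (1 : GC) Y = Y := by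
  have : (fun y => extChartAt 𝓘(ℂ, E) (1 : GC)
      (1 * (extChartAt 𝓘(ℂ, E) (1 : GC)).symm y * 1⁻¹))
      =ᶠ[nhds (extChartAt 𝓘(ℂ, E) (1 : GC) 1)] id := by
    filter_upwards [extChartAt_target_mem_nhds (I := 𝓘(ℂ, E)) (1 : GC)] with x hx
    rw [one_mul, inv_one, mul_one, PartialEquiv.right_inv _ hx, id]
  rw [adjointAction, this.fderiv_eq, fderiv_id]
  rfl

variable [LieGroup 𝓘(ℂ, E) ω GC]

theorem hasFDerivAt_chart_conj (a : GC) :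
    HasFDerivAt (fun y => extChartAt 𝓘(ℂ, E) (1 : GC)
      (a * (extChartAt 𝓘(ℂ, E) (1 : GC)).symm y * a⁻¹)) (adjointAction E a)
      (extChartAt 𝓘(ℂ, E) (1 : GC) 1) :=
  ((contDiffAt_chart_conj a).differentiableAt (by simp)).hasFDerivAt

/-- This is a exp(sX) a⁻¹ = exp(s Ad(a)X), by the chain rule in the chart. -/
theorem isOneParam_conj (a : GC) {γ : ℂ → GC} {X : GroupLieAlgebra 𝓘(ℂ, E) GC}
    (h : IsOneParam γ X) :
    IsOneParam (fun s => a * γ s * a⁻¹)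
      (show GroupLieAlgebra 𝓘(ℂ, E) GC from adjointAction E a (show E from X)) := by
  have := topologicalGroup_of_lieGroup 𝓘(ℂ, E) ω (G := GC)
  have h0 := isOneParam_zero h
  obtain ⟨hadd, hc, hd⟩ := isOneParam_iff.1 h
  refine isOneParam_iff.2 ⟨fun s t => by simp [hadd, mul_assoc], by fun_prop, ?_⟩
  have h1 : HasFDerivAt (fun y => extChartAt 𝓘(ℂ, E) (1 : GC)
      (a * (extChartAt 𝓘(ℂ, E) (1 : GC)).symm y * a⁻¹)) (adjointAction E a)
      (extChartAt 𝓘(ℂ, E) (1 : GC) (γ 0)) := by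
    rw [h0]; exact hasFDerivAt_chart_conj a
  refine (h1.comp_hasDerivAt (0 : ℂ) hd).congr_of_eventuallyEq ?_
  filter_upwards [eventually_symm_chart (E := E) hc h0] with s hs
  simp only [Function.comp_apply, hs]

theorem adjointAction_mul (a b : GC) (Y : E) :
    adjointAction E (a * b) Y = adjointAction E a (adjointAction E b Y) := by
  have := topologicalGroup_of_lieGroup 𝓘(ℂ, E) ω (G := GC)
  have hb := hasFDerivAt_chart_conj (E := E) b
  have ha : HasFDerivAt (fun y => extChartAt 𝓘(ℂ, E) (1 : GC)
      (a * (extChartAt 𝓘(ℂ, E) (1 : GC)).symm y * a⁻¹)) (adjointAction E a)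
      (extChartAt 𝓘(ℂ, E) (1 : GC)
        (b * (extChartAt 𝓘(ℂ, E) (1 : GC)).symm (extChartAt 𝓘(ℂ, E) (1 : GC) 1) * b⁻¹)) := by
    rw [chart_symm_one, mul_one, mul_inv_cancel]; exact hasFDerivAt_chart_conj a
  have hab := HasFDerivAt.comp (f := fun y => extChartAt 𝓘(ℂ, E) (1 : GC)
      (b * (extChartAt 𝓘(ℂ, E) (1 : GC)).symm y * b⁻¹)) _ ha hb
  have hc : ContinuousAt (fun y => b * (extChartAt 𝓘(ℂ, E) (1 : GC)).symm y * b⁻¹)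
      (extChartAt 𝓘(ℂ, E) (1 : GC) 1) := by
    have := continuousAt_extChartAt_symm (I := 𝓘(ℂ, E)) (1 : GC)
    fun_prop
  have hs : ∀ᶠ y in nhds (extChartAt 𝓘(ℂ, E) (1 : GC) 1),
      b * (extChartAt 𝓘(ℂ, E) (1 : GC)).symm y * b⁻¹ ∈ (extChartAt 𝓘(ℂ, E) (1 : GC)).source :=
    hc.eventually (by
      dsimp only
      rw [chart_symm_one, mul_one, mul_inv_cancel]; exact extChartAt_source_mem_nhds 1)
  have h := hab.congr_of_eventuallyEq (f₁ := fun y => extChartAt 𝓘(ℂ, E) (1 : GC)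
      (a * b * (extChartAt 𝓘(ℂ, E) (1 : GC)).symm y * (a * b)⁻¹)) (hs.mono fun y hy => by
    simp only [Function.comp_apply]
    rw [PartialEquiv.left_inv _ hy]
    simp [mul_assoc])
  rw [(hasFDerivAt_chart_conj (a * b)).unique h]
  rfl

variable [CompleteSpace E]

/-- The bracket of the Lie algebra of `GC`, as an operation on the model space. -/
def lieBracketModel {E : Type*} [NormedAddCommGroup E] [NormedSpace ℂ E] (GC : Type*)
    [TopologicalSpace GC] [ChartedSpace E GC] [Group GC] (X Y : E) : E :=
  Bracket.bracket (L := GroupLieAlgebra 𝓘(ℂ, E) GC) (M := GroupLieAlgebra 𝓘(ℂ, E) GC) X Y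

/-- Ad(x)Y is the y-derivative of xyx⁻¹, so its derivative at 1 is a mixed second derivative. By
`fderiv_fderiv_conj` this is the antisymmetrized mixed derivative of the product, which is the
bracket. -/
theorem exists_hasFDerivAt_adjointAction (Y : E) :
    ∃ L : E →L[ℂ] E, HasFDerivAt
      (fun x => adjointAction E ((extChartAt 𝓘(ℂ, E) (1 : GC)).symm x) Y) L
      (extChartAt 𝓘(ℂ, E) (1 : GC) 1) ∧
      ∀ X : E, L X = lieBracketModel GC X Y := by
  have := topologicalGroup_of_lieGroup 𝓘(ℂ, E) ω (G := GC)
  have hm := (contDiffAt_chart_mul (E := E) (GC := GC)).of_le (m := 2) le_top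
  have hc := (contDiffAt_chart_conj_prod (E := E) (GC := GC)).of_le (m := 2) le_top
  have hT := extChartAt_target_mem_nhds (I := 𝓘(ℂ, E)) (1 : GC)
  have hψ := continuousAt_extChartAt_symm (I := 𝓘(ℂ, E)) (1 : GC)
  refine ⟨_, hasFDerivAt_fderiv_snd hc Y, fun X => ?_⟩
  have key := fderiv_fderiv_conj hm hc ?_ ?_ ?_ ?_ X Y
  · refine Eq.trans ?_ (key.trans ?_)
    · rfl
    · refine Eq.trans ?_ (bracket_eq_fderiv X Y).symm
      have h1 := (hasFDerivAt_fderiv_snd hm Y).fderiv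
      have h2 := (hasFDerivAt_fderiv_snd hm X).fderiv
      exact congrArg₂ (· - ·) (DFunLike.congr_fun h1 X).symm
        (DFunLike.congr_fun h2 Y).symm
  · filter_upwards [hT] with x hx
    simp only [chart_symm_one, mul_one, PartialEquiv.right_inv _ hx]
  · filter_upwards [hT] with x hx
    simp only [chart_symm_one, one_mul, mul_one, inv_one, PartialEquiv.right_inv _ hx]
  · exact Filter.Eventually.of_forall fun x => by simp
  · have hcont : ContinuousAt (fun p : E × E => (extChartAt 𝓘(ℂ, E) (1 : GC)).symm p.1 *
        (extChartAt 𝓘(ℂ, E) (1 : GC)).symm p.2 * ((extChartAt 𝓘(ℂ, E) (1 : GC)).symm p.1)⁻¹)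
        (extChartAt 𝓘(ℂ, E) (1 : GC) 1, extChartAt 𝓘(ℂ, E) (1 : GC) 1) := by
      have h1 := hψ.comp (x := (extChartAt 𝓘(ℂ, E) (1 : GC) 1, extChartAt 𝓘(ℂ, E) (1 : GC) 1))
        (f := Prod.fst) continuousAt_fst
      have h2 := hψ.comp (x := (extChartAt 𝓘(ℂ, E) (1 : GC) 1, extChartAt 𝓘(ℂ, E) (1 : GC) 1))
        (f := Prod.snd) continuousAt_snd
      exact (h1.mul h2).mul h1.inv
    have hs := hcont.eventually (p := (· ∈ (extChartAt 𝓘(ℂ, E) (1 : GC)).source)) (by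
      simpa using! extChartAt_source_mem_nhds (I := 𝓘(ℂ, E)) (1 : GC))
    filter_upwards [hs] with p hp
    rw [PartialEquiv.left_inv _ hp]
    simp

theorem hasDerivAt_adjointAction_zero {γ : ℂ → GC} {X : E}
    (h : IsOneParam (E := E) γ X) (Y : E) :
    HasDerivAt (fun s => adjointAction E (γ s) Y) (lieBracketModel GC X Y) 0 := by
  have h0 := isOneParam_zero h
  obtain ⟨-, hc, hd⟩ := isOneParam_iff.1 h
  obtain ⟨L, hL, hLX⟩ := exists_hasFDerivAt_adjointAction (GC := GC) Y
  have hL' : HasFDerivAt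
      (fun x => adjointAction E ((extChartAt 𝓘(ℂ, E) (1 : GC)).symm x) Y) L
      (extChartAt 𝓘(ℂ, E) (1 : GC) (γ 0)) := by rwa [h0]
  rw [← hLX]
  have h1 := hL'.comp_hasDerivAt (0 : ℂ) hd
  refine h1.congr_of_eventuallyEq ?_
  filter_upwards [eventually_symm_chart (E := E) hc h0] with s hs
  simp only [Function.comp_apply, hs]

/-- Translate to 0 through Ad(γ t) = Ad(γ(t − s)) Ad(γ s). -/
theorem hasDerivAt_adjointAction {γ : ℂ → GC} {X : E}
    (h : IsOneParam (E := E) γ X) (Y : E) (s : ℂ) :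
    HasDerivAt (fun s => adjointAction E (γ s) Y)
      (lieBracketModel GC X (adjointAction E (γ s) Y)) s := by
  have h1 := hasDerivAt_adjointAction_zero h (adjointAction E (γ s) Y)
  rw [← sub_self s] at h1
  refine (h1.comp_sub_const s s).congr_of_eventuallyEq (Filter.Eventually.of_forall fun t => ?_)
  dsimp only
  have : γ t = γ (t - s) * γ s := by rw [← h.1, sub_add_cancel]
  rw [this, adjointAction_mul]

end AdjointAction

/-! ### Invariance under 𝔨, and the normalization of P⁺ and P⁻ by K_ℂ -/

section Invariance

variable {E : Type*} [NormedAddCommGroup E] [NormedSpace ℂ E]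
  {GC : Type*} [TopologicalSpace GC] [ChartedSpace E GC] [Group GC]
  [LieGroup 𝓘(ℂ, E) ω GC]

theorem adjointAction_mem_lieOf {K : Subgroup GC} {k : GC} (hk : k ∈ K)
    {Y : GroupLieAlgebra 𝓘(ℂ, E) GC} (hY : Y ∈ lieOf K) :
    (adjointAction E k Y : GroupLieAlgebra 𝓘(ℂ, E) GC) ∈ lieOf (E := E) K := by
  obtain ⟨γ, hγ, hK⟩ := hY
  exact ⟨_, isOneParam_conj k hγ, fun t => K.mul_mem (K.mul_mem hk (hK t)) (K.inv_mem hk)⟩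

variable [CompleteSpace E]

theorem hasDerivAt_adjointAction_real {γ : ℂ → GC} {X : E}
    (h : IsOneParam (E := E) γ X) (Y : E) (t : ℝ) :
    HasDerivAt (fun t : ℝ => adjointAction E (γ t) Y)
      (lieBracketModel GC X (adjointAction E (γ t) Y)) t := by
  simpa using! (hasDerivAt_adjointAction h Y (t : ℂ)).scomp t Complex.ofRealCLM.hasDerivAt

variable {g : LieSubalgebra ℝ (GroupLieAlgebra 𝓘(ℂ, E) GC)} {K : Subgroup GC}

/-- A real form which is simple is its own normalizer. -/
theorem mem_of_forall_lie_mem (hform : IsRealForm g) (hsimple : LieAlgebra.IsSimple ℝ g)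
    {X : GroupLieAlgebra 𝓘(ℂ, E) GC} (hX : ∀ Y ∈ g, ⁅X, Y⁆ ∈ g) : X ∈ g := by
  obtain ⟨⟨A, B⟩, hAB⟩ := hform.2 X
  dsimp only at hAB
  -- With X = A + iB, the element [X, Y] = [A, Y] + i[B, Y] lies in 𝔤, so uniqueness of the
  -- decomposition forces [B, Y] = 0. Thus B is central, hence zero.
  have hB (Y : g) : ⁅B, Y⁆ = 0 := by
    have h1 : (A : GroupLieAlgebra 𝓘(ℂ, E) GC) + Complex.I • (B : GroupLieAlgebra 𝓘(ℂ, E) GC)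
        = X := hAB
    have := @hform.1 (⟨⁅X, (Y : GroupLieAlgebra 𝓘(ℂ, E) GC)⁆, hX Y Y.2⟩, 0) (⁅A, Y⁆, ⁅B, Y⁆) (by
      simp only [LieSubalgebra.coe_bracket, ← h1, add_lie, smul_lie]
      simp)
    exact (congrArg Prod.snd this).symm
  have hB0 : B ∈ LieAlgebra.center ℝ g := by
    rw [LieModule.mem_maxTrivSubmodule]
    intro Y
    rw [← lie_skew, hB, neg_zero]
  rw [LieAlgebra.center_eq_bot, LieSubmodule.mem_bot] at hB0
  rw [← hAB, hB0]
  simp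

theorem lie_eq_zero_of_mem_span_lieOf {Z X : GroupLieAlgebra 𝓘(ℂ, E) GC}
    (hZ : ∀ X ∈ lieOf (E := E) K, ⁅Z, X⁆ = 0) (hX : X ∈ Submodule.span ℂ (lieOf (E := E) K)) :
    ⁅Z, X⁆ = 0 := by
  induction hX using Submodule.span_induction with
  | mem x hx => exact hZ x hx
  | zero => simp
  | add x y _ _ h1 h2 => rw [lie_add, h1, h2, add_zero]
  | smul r x _ h => rw [lie_smul, h, smul_zero]

variable [FiniteDimensional ℂ E]

/-- Real subspaces invariant under `ad X` are invariant under `Ad (exp (t X))`. -/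
theorem adjointAction_mem {γ : ℂ → GC} {X : GroupLieAlgebra 𝓘(ℂ, E) GC} (h : IsOneParam γ X)
    {S : Submodule ℝ (GroupLieAlgebra 𝓘(ℂ, E) GC)} (hS : ∀ Y ∈ S, ⁅X, Y⁆ ∈ S)
    {Y : GroupLieAlgebra 𝓘(ℂ, E) GC} (hY : Y ∈ S) (t : ℝ) :
    (adjointAction E (γ t) Y : GroupLieAlgebra 𝓘(ℂ, E) GC) ∈ S := by
  have : FiniteDimensional ℝ E := FiniteDimensional.complexToReal E
  let S' : Submodule ℝ E := S
  let D₀ : E →ₗ[ℂ] E := LieAlgebra.ad ℂ (GroupLieAlgebra 𝓘(ℂ, E) GC) X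
  let D : E →L[ℝ] E := (LinearMap.toContinuousLinearMap D₀).restrictScalars ℝ
  have h0 : adjointAction E (γ ((0 : ℝ) : ℂ)) Y ∈ S' := by
    rw [Complex.ofReal_zero, isOneParam_zero h]
    exact (adjointAction_one (GC := GC) (E := E) Y).symm ▸ hY
  exact mem_of_hasDerivAt_clm_apply (D := D) (S := S')
    (hasDerivAt_adjointAction_real h Y) S'.closed_of_finiteDimensional hS h0 t

/-- If `Ad (exp (t X)) Y` stays in a real subspace, then so does `[X, Y]`. -/
theorem lie_mem_of_adjointAction_mem {γ : ℂ → GC} {X : GroupLieAlgebra 𝓘(ℂ, E) GC}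
    (h : IsOneParam γ X) {S : Submodule ℝ (GroupLieAlgebra 𝓘(ℂ, E) GC)}
    {Y : GroupLieAlgebra 𝓘(ℂ, E) GC}
    (hY : ∀ t : ℝ, (adjointAction E (γ t) Y : GroupLieAlgebra 𝓘(ℂ, E) GC) ∈ S) :
    ⁅X, Y⁆ ∈ S := by
  have : FiniteDimensional ℝ E := FiniteDimensional.complexToReal E
  let S' : Submodule ℝ E := S
  have h0 : HasDerivAt (fun t : ℝ => adjointAction E (γ t) Y) (lieBracketModel GC X (Y : E)) 0 := by
    have := hasDerivAt_adjointAction_real h Y 0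
    rw [Complex.ofReal_zero, isOneParam_zero h] at this
    rwa [show adjointAction E (1 : GC) Y = (Y : E) from adjointAction_one (GC := GC) (E := E) Y]
      at this
  -- A derivative lies in the closed span of the values of the curve.
  have hmem := range_deriv_subset_closure_span_image (fun t : ℝ => adjointAction E (γ t) (Y : E))
    dense_univ ⟨0, h0.deriv⟩
  have hle : Submodule.span ℝ ((fun t : ℝ => adjointAction E (γ t) (Y : E)) '' Set.univ) ≤ S' :=
    Submodule.span_le.2 (by rintro _ ⟨t, -, rfl⟩; exact hY t)
  exact closure_minimal hle S'.closed_of_finiteDimensional hmem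

/-- The adjoint action of the analytic subgroup of a Lie subalgebra preserves the subalgebra. -/
theorem adjointAction_mem_of_mem_analyticSubgroup
    {a : GC} (ha : a ∈ analyticSubgroup (g : Set (GroupLieAlgebra 𝓘(ℂ, E) GC)))
    {Y : GroupLieAlgebra 𝓘(ℂ, E) GC} (hY : Y ∈ g) :
    (adjointAction E a Y : GroupLieAlgebra 𝓘(ℂ, E) GC) ∈ g := by
  have hgen {γ : ℂ → GC} {X : GroupLieAlgebra 𝓘(ℂ, E) GC} (hX : X ∈ g) (h : IsOneParam γ X)
      {Y : GroupLieAlgebra 𝓘(ℂ, E) GC} (hY : Y ∈ g) (t : ℝ) :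
      (adjointAction E (γ t) Y : GroupLieAlgebra 𝓘(ℂ, E) GC) ∈ g :=
    adjointAction_mem (S := g.toSubmodule) h (fun W hW => g.lie_mem hX hW) hY t
  unfold analyticSubgroup at ha
  induction ha using Subgroup.closure_induction'' generalizing Y with
  | mem x hx =>
    obtain ⟨X, hX, γ, hγ, rfl⟩ := hx
    simpa using! hgen hX hγ hY 1
  | inv_mem x hx =>
    obtain ⟨X, hX, γ, hγ, rfl⟩ := hx
    have : (γ 1)⁻¹ = γ ((-1 : ℝ) : ℂ) := by
      rw [inv_eq_iff_mul_eq_one, ← hγ.1]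
      simpa using! isOneParam_zero hγ
    rw [this]
    exact hgen hX hγ hY (-1)
  | one => exact (adjointAction_one (GC := GC) (E := E) Y).symm ▸ hY
  | mul x y _ _ hx hy =>
    have := hx (hy hY)
    exact (adjointAction_mul (E := E) x y Y).symm ▸ this

/-- The curve Ad(exp tX)W stays in `lieOf K`; differentiate at 0. The span appears because `lieOf
K`, defined by one-parameter groups, has not been shown to be a subspace. -/
theorem lie_mem_span_lieOf {X W : GroupLieAlgebra 𝓘(ℂ, E) GC}
    (hX : X ∈ lieOf K) (hW : W ∈ lieOf K) :
    ⁅X, W⁆ ∈ Submodule.span ℝ (lieOf (E := E) K) := by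
  obtain ⟨γ, hγ, hK⟩ := hX
  exact lie_mem_of_adjointAction_mem (E := E) hγ fun t =>
    Submodule.subset_span (adjointAction_mem_lieOf (E := E) (hK t) hW)

theorem lie_mem_of_mem_lieOf
    (hK : K ≤ analyticSubgroup (g : Set (GroupLieAlgebra 𝓘(ℂ, E) GC)))
    {X Y : GroupLieAlgebra 𝓘(ℂ, E) GC} (hX : X ∈ lieOf K) (hY : Y ∈ g) : ⁅X, Y⁆ ∈ g := by
  obtain ⟨γ, hγ, hγK⟩ := hX
  exact lie_mem_of_adjointAction_mem (S := g.toSubmodule) hγ fun t =>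
    adjointAction_mem_of_mem_analyticSubgroup (hK (hγK t)) hY

/-- Only K ≤ G is needed: Ad(G) preserves 𝔤, so every X in `lieOf K` normalizes 𝔤 and therefore lies
in it. -/
theorem lieOf_subset (hform : IsRealForm g) (hsimple : LieAlgebra.IsSimple ℝ g)
    (hK : K ≤ analyticSubgroup (g : Set (GroupLieAlgebra 𝓘(ℂ, E) GC))) :
    lieOf (E := E) K ⊆ g :=
  fun _ hX => mem_of_forall_lie_mem hform hsimple fun _ hY => lie_mem_of_mem_lieOf hK hX hY

/-- Invariance of the Killing form: κ(W, [X, Y]) = κ([W, X], Y), which vanishes as [W, X] is in the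
real span of 𝔨. -/
theorem lie_mem_cartanComplement (hKg : lieOf (E := E) K ⊆ g)
    {X Y : GroupLieAlgebra 𝓘(ℂ, E) GC} (hX : X ∈ lieOf K) (hY : Y ∈ cartanComplement g K) :
    ⁅X, Y⁆ ∈ cartanComplement g K := by
  obtain ⟨hYg, hYK⟩ := hY
  refine ⟨g.lie_mem (hKg hX) hYg, fun W hW => ?_⟩
  -- Orthogonality to Y is a linear condition, so it passes from `lieOf K` to its real span.
  have hspan : Submodule.span ℝ (lieOf (E := E) K) ≤
      (LinearMap.ker ((killingForm ℝ g).flip ⟨Y, hYg⟩)).map g.toSubmodule.subtype :=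
    Submodule.span_le.2 fun V hV => ⟨⟨V, hKg hV⟩, hYK ⟨V, hKg hV⟩ hV, rfl⟩
  obtain ⟨V, hV, hVe⟩ := hspan (lie_mem_span_lieOf hW hX)
  have hVe' : V = ⁅W, (⟨X, hKg hX⟩ : g)⁆ := Subtype.ext hVe
  have := LieModule.traceForm_apply_lie_apply ℝ g g W ⟨X, hKg hX⟩ ⟨Y, hYg⟩
  rw [← hVe'] at this
  exact this.symm.trans hV

theorem lie_mem_span_cartanComplement (hKg : lieOf (E := E) K ⊆ g)
    {X Y : GroupLieAlgebra 𝓘(ℂ, E) GC} (hX : X ∈ Submodule.span ℂ (lieOf (E := E) K))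
    (hY : Y ∈ Submodule.span ℂ (cartanComplement g K)) :
    ⁅X, Y⁆ ∈ Submodule.span ℂ (cartanComplement g K) := by
  induction hX, hY using Submodule.span_induction₂ with
  | mem_mem x y hx hy => exact Submodule.subset_span (lie_mem_cartanComplement hKg hx hy)
  | zero_left y hy => simp
  | zero_right x hx => simp
  | add_left x y z _ _ _ h1 h2 => rw [add_lie]; exact add_mem h1 h2
  | add_right x y z _ _ _ h1 h2 => rw [lie_add]; exact add_mem h1 h2
  | smul_left r x y _ _ h => rw [smul_lie]; exact Submodule.smul_mem _ r h
  | smul_right r x y _ _ h => rw [lie_smul]; exact Submodule.smul_mem _ r h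

/-- Ad(exp tX) preserves the eigenspace because ad X does, so conjugation permutes the generators
exp Y among themselves. Here X may be complex; real t suffices, as only t = ±1 matters for the
normalizer. -/
theorem conj_mem_eigenSubgroup (hKg : lieOf (E := E) K ⊆ g)
    {Z X : GroupLieAlgebra 𝓘(ℂ, E) GC} (hZ : ∀ X ∈ lieOf (E := E) K, ⁅Z, X⁆ = 0)
    (hX : X ∈ Submodule.span ℂ (lieOf (E := E) K)) {γ : ℂ → GC} (hγ : IsOneParam γ X)
    (c : ℂ) (t : ℝ) {p : GC} (hp : p ∈ eigenSubgroup g K Z c) :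
    γ t * p * (γ t)⁻¹ ∈ eigenSubgroup g K Z c := by
  let S : Submodule ℂ (GroupLieAlgebra 𝓘(ℂ, E) GC) :=
    { carrier := {Y | Y ∈ Submodule.span ℂ (cartanComplement g K) ∧ ⁅Z, Y⁆ = c • Y}
      add_mem' := fun ha hb => ⟨add_mem ha.1 hb.1, by rw [lie_add, ha.2, hb.2, smul_add]⟩
      zero_mem' := ⟨zero_mem _, by simp⟩
      smul_mem' := fun r x hx => ⟨Submodule.smul_mem _ r hx.1, by
        rw [lie_smul, hx.2, smul_comm]⟩ }
  have hS (Y : GroupLieAlgebra 𝓘(ℂ, E) GC) (hY : Y ∈ S.restrictScalars ℝ) :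
      ⁅X, Y⁆ ∈ S.restrictScalars ℝ := by
    refine ⟨lie_mem_span_cartanComplement hKg hX hY.1, ?_⟩
    -- [Z, [X, Y]] = [[Z, X], Y] + [X, [Z, Y]] = 0 + c[X, Y].
    rw [leibniz_lie, lie_eq_zero_of_mem_span_lieOf hZ hX, zero_lie, zero_add, hY.2, lie_smul]
  unfold eigenSubgroup analyticSubgroup at hp
  induction hp using Subgroup.closure_induction with
  | mem x hx =>
    obtain ⟨Y, hY, δ, hδ, rfl⟩ := hx
    exact Subgroup.subset_closure
      ⟨_, adjointAction_mem hγ hS hY t, _, isOneParam_conj (γ t) hδ, rfl⟩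
  | one => simp [one_mem]
  | mul x y _ _ hx hy => simpa [mul_assoc] using mul_mem hx hy
  | inv x _ hx => simpa [mul_assoc] using inv_mem hx

/-- `KC` normalizes `P⁺` and `P⁻`. -/
theorem complexifiedSubgroup_le_normalizer (hKg : lieOf (E := E) K ⊆ g)
    {Z : GroupLieAlgebra 𝓘(ℂ, E) GC} (hZ : ∀ X ∈ lieOf (E := E) K, ⁅Z, X⁆ = 0) (c : ℂ) :
    complexifiedSubgroup E K ≤ Subgroup.normalizer (eigenSubgroup g K Z c : Set GC) := by
  refine (Subgroup.closure_le _).2 ?_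
  rintro _ ⟨X, hX, γ, hγ, rfl⟩
  refine Subgroup.mem_normalizer_iff.2 fun p => ⟨fun hp => ?_, fun hp => ?_⟩
  · simpa using! conj_mem_eigenSubgroup hKg hZ hX hγ c 1 hp
  · have hinv : γ ((-1 : ℝ) : ℂ) = (γ 1)⁻¹ := by
      rw [eq_inv_iff_mul_eq_one, ← hγ.1]
      simpa using! isOneParam_zero hγ
    have := conj_mem_eigenSubgroup hKg hZ hX hγ c (-1) hp
    rw [hinv] at this
    simpa [mul_assoc] using this

end Invariance

/-! ### Coset computations in the flag varieties -/

section Flags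

variable {GC : Type*} [Group GC]

theorem transversal_toFlags (KC Pp Pm : Subgroup GC) (a : GC) :
    Transversal KC Pp Pm (toFlags KC Pp Pm a).1 (toFlags KC Pp Pm a).2 :=
  ⟨a, rfl, 1, one_mem _, by rw [mul_one]; rfl⟩

/-- Normalization makes the set `KC * P` equal to the subgroup `KC ⊔ P`, so G K_ℂ P is stable under
right multiplication by it and is the full preimage of its image. -/
theorem mk_mem_flagDomain_iff {G KC P : Subgroup GC} (h : KC ≤ Subgroup.normalizer (P : Set GC))
    (a : GC) : (a : Flag KC P) ∈ flagDomain G KC P ↔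
      a ∈ (G : Set GC) * (KC : Set GC) * (P : Set GC) := by
  refine ⟨?_, fun ha => ⟨a, ha, rfl⟩⟩
  rw [mul_assoc, ← Subgroup.coe_mul_of_left_le_normalizer_right KC P h]
  rintro ⟨b, hb, hba⟩
  rw [mul_assoc, ← Subgroup.coe_mul_of_left_le_normalizer_right KC P h] at hb
  obtain ⟨x, hx, y, hy, rfl⟩ := hb
  refine ⟨x, hx, x⁻¹ * a, ?_, by simp⟩
  have := mul_mem hy (QuotientGroup.eq.1 hba)
  simpa [mul_assoc] using this

/-- Transversality is automatic on the image of X_ℂ, leaving only membership in the flag domain. -/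
theorem preimageInGroup_XiPlus {G KC Pp Pm : Subgroup GC}
    (h : KC ≤ Subgroup.normalizer (Pp : Set GC)) :
    preimageInGroup KC (XiPlus G KC Pp Pm) =
      (G : Set GC) * (KC : Set GC) * (Pp : Set GC) := by
  ext a
  rw [← mk_mem_flagDomain_iff h]
  exact ⟨fun ha => ha.1, fun ha => ⟨ha, trivial, transversal_toFlags KC Pp Pm a⟩⟩

theorem preimageInGroup_XiMinus {G KC Pp Pm : Subgroup GC}
    (h : KC ≤ Subgroup.normalizer (Pm : Set GC)) :
    preimageInGroup KC (XiMinus G KC Pp Pm) =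
      (G : Set GC) * (KC : Set GC) * (Pm : Set GC) := by
  ext a
  rw [← mk_mem_flagDomain_iff h]
  exact ⟨fun ha => ha.2.1, fun ha => ⟨trivial, ha, transversal_toFlags KC Pp Pm a⟩⟩

end Flags

end HermitianCrown

end

theorem proposition3p9
    {E : Type*} [NormedAddCommGroup E] [NormedSpace ℂ E] [CompleteSpace E]
    [FiniteDimensional ℂ E]
    -- the simply connected complex Lie group `G_ℂ`
    {GC : Type*} [TopologicalSpace GC] [ChartedSpace E GC] [Group GC]
    [LieGroup 𝓘(ℂ, E) ω GC] [SimplyConnectedSpace GC]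
    -- the Lie algebra of `G`: a simple real form of the Lie algebra of `G_ℂ`
    (g : LieSubalgebra ℝ (GroupLieAlgebra 𝓘(ℂ, E) GC)) (hform : IsRealForm g)
    (hsimple : LieAlgebra.IsSimple ℝ g)
    -- the connected non-compact group `G` with Lie algebra `g`, and a maximal compact subgroup
    (G K : Subgroup GC)
    (hG : G = analyticSubgroup (g : Set (GroupLieAlgebra 𝓘(ℂ, E) GC)))
    (hnc : ¬ IsCompact (G : Set GC))
    (hK : Maximal (fun L : Subgroup GC => L ≤ G ∧ IsCompact (L : Set GC)) K)
    -- `G` is of Hermitian type; `Z` fixes the choice of `P⁺` and `P⁻`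
    (Z : GroupLieAlgebra 𝓘(ℂ, E) GC) (hZ : IsHermitianElement g K Z)
    (KC Pp Pm : Subgroup GC) (hKC : KC = complexifiedSubgroup E K)
    (hPp : Pp = PPlus g K Z) (hPm : Pm = PMinus g K Z) :
    preimageInGroup KC (XiPlus G KC Pp Pm) =
        (G : Set GC) * (KC : Set GC) * (Pp : Set GC) ∧
      preimageInGroup KC (XiMinus G KC Pp Pm) =
        (G : Set GC) * (KC : Set GC) * (Pm : Set GC) := by
  subst hPp hPm hKC
  have hKG : K ≤ analyticSubgroup (g : Set (GroupLieAlgebra 𝓘(ℂ, E) GC)) := hG ▸ hK.prop.1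
  have hKg := lieOf_subset hform hsimple hKG
  exact ⟨preimageInGroup_XiPlus (complexifiedSubgroup_le_normalizer hKg hZ.2.1 _),
    preimageInGroup_XiMinus (complexifiedSubgroup_le_normalizer hKg hZ.2.1 _)⟩
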